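/- Let $L$ be a first-order language and let $K$ be an $L$-structure that expands a field (so that addition and multiplication are definable without parameters, and there may be additional structure). Let $\kappa$ be an infinite cardinal and suppose that $K$ is $\kappa$-saturated. Let $\mathcal{O}$ be a valuation subring of $K$ (possibly $\mathcal{O} = K$) that is $\vee$-definable, i.e. $\mathcal{O}$ is a union of sets each of which is definable over $A$, for some $A \subseteq K$ with $|A| < \kappa$. Then $\mathcal{O}$ is externally definable: there are an elementary extension $N \succeq K$ and a set $T \subseteq N$ definable in $N$ with parameters from $N$ such that $\mathcal{O} = T \cap K$. If moreover $K$ is NIP (no formula $\varphi(x;y)$ in finite tuples of variables shatters arbitrarily large finite sets of tuples in $K$), then every ideal of $\mathcal{O}$ (including the improper one) is externally definable. -/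

import Mathlib

open FirstOrder Cardinal

universe u v w

namespace FieldModelTheory

/-- An `L`-structure on a field `K` expands the field `(K, +, ·)`: the graphs of addition and of
multiplication are definable in it without parameters. (This is so in particular when symbols for
`+` and `·` belong to `L`; it does not matter which symbols of ring theory are taken as basic, and
`L` may have any further symbols.) -/
structure ExpandsField (L : FirstOrder.Language.{u, v}) (K : Type w) [Field K] [L.Structure K] : Prop where
  definable_add : (∅ : Set K).Definable L {x : Fin 3 → K | x 0 + x 1 = x 2}
  definable_mul : (∅ : Set K).Definable L {x : Fin 3 → K | x 0 * x 1 = x 2}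

/-- `M` is `κ`-saturated: every partial type `p` in one variable over a set of fewer than `κ`
parameters (a set of formulas that is finitely satisfiable in `M`) is realised in `M`. -/
def IsSaturated (L : FirstOrder.Language.{u, v}) (M : Type w) [L.Structure M] (κ : Cardinal.{w}) : Prop :=
  ∀ A : Set M, #A < κ → ∀ p : Set (L[[A]].Formula (Fin 1)),
    (∀ q : Finset (L[[A]].Formula (Fin 1)), (q : Set (L[[A]].Formula (Fin 1))) ⊆ p →
      ∃ a : Fin 1 → M, ∀ φ ∈ q, φ.Realize a) →
    ∃ a : Fin 1 → M, ∀ φ ∈ p, φ.Realize a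

/-- `S ⊆ M` is `∨`-definable, small meaning of cardinality less than `κ`: it is a union of
(arbitrarily many) sets that are definable over one common small set `A` of parameters. -/
def IsVeeDefinable (L : FirstOrder.Language.{u, v}) {M : Type w} [L.Structure M] (κ : Cardinal.{w})
    (S : Set M) : Prop :=
  ∃ A : Set M, #A < κ ∧ ∃ 𝒟 : Set (Set M), (∀ D ∈ 𝒟, A.Definable₁ L D) ∧ S = ⋃₀ 𝒟

/-- `S ⊆ M` is externally definable: it is the trace on `M` of a set that is definable, with
arbitrary parameters, in some elementary extension `N` of `M`. -/
def IsExternallyDefinable (L : FirstOrder.Language.{u, v}) {M : Type w} [L.Structure M] (S : Set M) : Prop :=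
  ∃ (N : Type (max u v w)) (_ : L.Structure N) (f : M ↪ₑ[L] N) (T : Set N),
    (Set.univ : Set N).Definable₁ L T ∧ S = f ⁻¹' T

/-- `M` is NIP: for every formula `φ(x; y)`, with `x` and `y` finite tuples of variables, there is
a `k` such that `φ` does not shatter any `k` tuples of `M`. -/
def IsNIP (L : FirstOrder.Language.{u, v}) (M : Type w) [L.Structure M] : Prop :=
  ∀ (m n : ℕ) (φ : L.Formula (Fin m ⊕ Fin n)), ∃ k : ℕ,
    ¬ ∃ (a : Fin k → Fin m → M) (b : Set (Fin k) → Fin n → M),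
      ∀ (i : Fin k) (s : Set (Fin k)), φ.Realize (Sum.elim (a i) (b s)) ↔ i ∈ s

end FieldModelTheory

/-! Write `v` for the valuation of `O` and `m` for its maximal ideal. Since `x ∈ O` or `x⁻¹ ∈ O` for
all `x`, saturation yields a definable `D` with `m ⊆ D ⊆ O`. If `v` takes no largest negative value
and `O ≠ K`, then for `c ∉ O` one has `O ⊆ c • m ⊆ c • D ⊆ c • O`, and for `v c` close enough to `0`
the outer terms agree on a given finite set. If `v` does take a largest negative value, the
complement of `O` is `∨`-definable too, and compactness makes `O` definable. An ideal agrees on each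
finite set with some `s • O`, since divisibility in `O` is total, hence with some `(s * c) • D`. So
a single relation `x ∈ c • D` approximates every ideal on finite sets, and an ultrapower glues the
parameters into one external parameter. -/

namespace FirstOrder.Language

/-- The diagonal embedding of a structure into its ultrapower is elementary. -/
def Ultraproduct.diagonal (L : FirstOrder.Language.{u, v}) (M : Type*) [L.Structure M] [Nonempty M]
    {ι : Type*} (U : Ultrafilter ι) :
    M ↪ₑ[L] (U : Filter ι).Product (fun _ : ι => M) where
  toFun a := ((fun _ => a : ι → M) : (U : Filter ι).Product (fun _ : ι => M))
  map_formula' n φ x := by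
    refine (Ultraproduct.realize_formula_cast (u := U) φ fun i _ => x i).trans ?_
    exact Filter.eventually_const

end FirstOrder.Language

namespace FieldModelTheory

variable {L : FirstOrder.Language.{u, v}} {M : Type w} [L.Structure M]

/-- A set is externally definable if it agrees on every finite set with some fibre of one fixed
definable relation. -/
theorem isExternallyDefinable_of_finite_approx [Nonempty M] {A : Set M} {R : Set (Fin 2 → M)}
    (hR : A.Definable L R) {S : Set M}
    (hS : ∀ F : Finset M, ∃ c, ∀ x ∈ F, x ∈ S ↔ ![x, c] ∈ R) : IsExternallyDefinable L S := by
  classical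
  obtain ⟨φ, rfl⟩ := Set.definable_iff_exists_formula_sum.1 hR
  choose c hc using hS
  -- As `U` refines `atTop`, each `x` lies in `U`-almost every `F`; hence the class of `c` in the
  -- ultrapower decides membership in `S` correctly at every `x`.
  let U : Ultrafilter (Finset M) := Ultrafilter.of Filter.atTop
  let P := (U : Filter (Finset M)).Product (fun _ => M)
  let N := ULift.{max u v w} P
  let _ : L.Structure N := Equiv.inducedStructure Equiv.ulift.symm
  let e : P ≃[L] N := Equiv.inducedStructureEquiv Equiv.ulift.symm
  let f : M ↪ₑ[L] N := e.toElementaryEmbedding.comp (FirstOrder.Language.Ultraproduct.diagonal L M U)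
  let d : N := e (c : P)
  refine ⟨N, inferInstance, f,
    {y | φ.Realize (Sum.elim (fun a : A => f a) ![y, d])}, ?_, ?_⟩
  · refine Set.definable_iff_exists_formula_sum.2
      ⟨φ.relabel (Sum.elim (fun a : A => Sum.inl ⟨f a, trivial⟩)
        ![Sum.inr 0, Sum.inl ⟨d, trivial⟩] : A ⊕ Fin 2 → (Set.univ : Set N) ⊕ Fin 1), ?_⟩
    ext y
    simp only [Set.mem_ofPred_eq, FirstOrder.Language.Formula.realize_relabel]
    refine iff_of_eq (congrArg _ (funext ?_))
    rintro (a | i)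
    · rfl
    · fin_cases i <;> rfl
  · ext x
    have key : φ.Realize (Sum.elim (fun a : A => f a) ![f x, d]) ↔
        ∀ᶠ F in (U : Filter (Finset M)), φ.Realize (Sum.elim (fun a : A => (a : M)) ![x, c F]) := by
      have h₁ := FirstOrder.Language.Ultraproduct.realize_formula_cast (u := U) φ
        (Sum.elim (fun a _ => (a : M)) ![fun _ => x, c])
      have h₂ := FirstOrder.Language.StrongHomClass.realize_formula e φ
        (v := fun i => ((Sum.elim (fun (a : A) _ => (a : M)) ![fun _ => x, c] i :
          Finset M → M) : P))
      refine Iff.trans ?_ (h₂.trans (h₁.trans ?_))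
      · refine iff_of_eq (congrArg _ (funext ?_))
        rintro (a | i)
        · rfl
        · fin_cases i <;> rfl
      · refine iff_of_eq (congrArg (fun p => ∀ᶠ F in (U : Filter (Finset M)), p F) (funext fun F => ?_))
        refine congrArg _ (funext ?_)
        rintro (a | i)
        · rfl
        · fin_cases i <;> rfl
    have hx : ∀ᶠ F in (U : Filter (Finset M)), x ∈ F :=
      Ultrafilter.of_le _ ((Filter.eventually_ge_atTop {x}).mono fun F hF => hF (by simp))
    refine Iff.trans ?_ key.symm
    refine (Filter.eventually_const (f := (U : Filter (Finset M)))).symm.trans ?_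
    refine Filter.eventually_congr (hx.mono fun F hF => ?_)
    simpa [Function.comp_def] using hc F x hF

/-- A cover of a saturated structure by sets that are definable over one small set has a finite
subcover. -/
theorem IsSaturated.exists_finite_subcover {κ : Cardinal.{w}} (hsat : IsSaturated L M κ) {A : Set M}
    (hA : #A < κ) {𝒞 : Set (Set M)} (h𝒞 : ∀ D ∈ 𝒞, A.Definable₁ L D)
    (hcover : ∀ x, ∃ D ∈ 𝒞, x ∈ D) :
    ∃ 𝒟 : Set (Set M), 𝒟 ⊆ 𝒞 ∧ 𝒟.Finite ∧ ∀ x, ∃ D ∈ 𝒟, x ∈ D := by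
  by_contra! hcon
  let s (φ : L[[A]].Formula (Fin 1)) : Set M := {x | ¬ φ.Realize fun _ => x}
  -- This type says that its realisation avoids every member of `𝒞`.
  obtain ⟨a, ha⟩ := hsat A hA {φ | s φ ∈ 𝒞} fun q hq => by
    obtain ⟨x, hx⟩ := hcon (s '' q) (by rintro _ ⟨φ, hφ, rfl⟩; exact hq hφ)
      (q.finite_toSet.image s)
    exact ⟨fun _ => x, fun φ hφ => not_not.1 (hx _ ⟨φ, hφ, rfl⟩)⟩
  obtain ⟨D, hD, haD⟩ := hcover (a 0)
  obtain ⟨φ, hφ⟩ := (h𝒞 D hD).compl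
  have hs : s φ = D := by
    ext x
    have := congrArg (fun T => (fun _ => x) ∈ T) hφ
    simp only [Set.mem_compl_iff, Set.mem_ofPred_eq, eq_iff_iff] at this
    simp only [s, Set.mem_ofPred_eq]
    rw [← this, not_not]
  have h := ha φ (by simpa [hs] using hD)
  have : a 0 ∈ s φ := hs ▸ haD
  refine this ?_
  convert h using 2 with i
  rw [Subsingleton.elim i 0]

variable {K : Type w} [Field K] [L.Structure K] {A : Set K}

/-- The fibres over `v 1 = c` are the multiples `c • D`, the family that approximates all ideals. -/
theorem ExpandsField.definable_exists_mul_eq (hK : ExpandsField L K) {D : Set K}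
    (hD : A.Definable₁ L D) : A.Definable L {v : Fin 2 → K | ∃ y ∈ D, v 1 * y = v 0} := by
  have h₁ := (hK.definable_mul.mono (Set.empty_subset A)).preimage_comp
    (![Sum.inl 1, Sum.inr 0, Sum.inl 0] : Fin 3 → Fin 2 ⊕ Fin 1)
  have h₂ := Set.Definable.preimage_comp (fun _ => Sum.inr 0 : Fin 1 → Fin 2 ⊕ Fin 1) hD
  convert (h₂.inter h₁).exists_of_finite using 1
  ext v
  constructor
  · rintro ⟨y, hy, h⟩
    exact ⟨fun _ => y, hy, h⟩
  · rintro ⟨u, hu, h⟩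
    exact ⟨u 0, hu, h⟩

theorem ExpandsField.definable₁_exists_mul_eq (hK : ExpandsField L K) {D : Set K}
    (hD : A.Definable₁ L D) {t : K} (ht : t ∈ A) : A.Definable₁ L {x | ∃ y ∈ D, x * y = t} := by
  have h := ((hK.definable_exists_mul_eq hD).inter
    ((Set.Definable.singleton_of_mem (L := L) ht).preimage_comp
      (fun _ => 0 : _ → Fin 2))).image_comp (fun _ => 1 : Fin 1 → Fin 2)
  unfold Set.Definable₁
  convert h using 1
  ext v
  constructor
  · rintro ⟨y, hy, h⟩
    refine ⟨![t, v 0], ⟨⟨y, hy, h⟩, ?_⟩, ?_⟩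
    · simp
    · ext i; rw [Subsingleton.elim i 0]; rfl
  · rintro ⟨u, ⟨⟨y, hy, h⟩, hu⟩, rfl⟩
    refine ⟨y, hy, h.trans ?_⟩
    simpa using hu

/-- If `O` and `t • O⁻¹` cover a saturated field, where `O` is a `∨`-definable set, then so do
`D` and `t • O⁻¹` for some definable `D ⊆ O`. -/
theorem IsVeeDefinable.exists_definable_subset {κ : Cardinal.{w}} (hκ : ℵ₀ ≤ κ)
    (hsat : IsSaturated L K κ) (hK : ExpandsField L K) {S : Set K} (hS : IsVeeDefinable L κ S)
    (h₀ : 0 ∈ S) {t : K} (ht : t ≠ 0) (hcover : ∀ x, x ∈ S ∨ x ≠ 0 ∧ t * x⁻¹ ∈ S) :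
    ∃ D ⊆ S, (Set.univ : Set K).Definable₁ L D ∧ 0 ∈ D ∧ ∀ x, x ∈ D ∨ t * x⁻¹ ∈ S := by
  obtain ⟨A, hA, 𝒟, h𝒟, rfl⟩ := hS
  have hA' : #(insert t A : Set K) < κ :=
    (Cardinal.mk_insert_le).trans_lt (Cardinal.add_lt_of_lt hκ hA (Cardinal.one_lt_aleph0.trans_le hκ))
  have h𝒟' : ∀ D ∈ 𝒟, (insert t A).Definable₁ L D :=
    fun D hD => Set.Definable.mono (h𝒟 D hD) (Set.subset_insert _ _)
  obtain ⟨ℱ, hℱ, hfin, hcov⟩ := hsat.exists_finite_subcover hA'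
    (𝒞 := 𝒟 ∪ (fun D => {x | ∃ y ∈ D, x * y = t}) '' 𝒟)
    (by
      rintro _ (hD | ⟨D, hD, rfl⟩)
      · exact h𝒟' _ hD
      · exact hK.definable₁_exists_mul_eq (h𝒟' D hD) (Set.mem_insert _ _))
    (fun x => by
      rcases hcover x with ⟨D, hD, hx⟩ | ⟨hx₀, D, hD, hx⟩
      · exact ⟨D, Or.inl hD, hx⟩
      · exact ⟨_, Or.inr ⟨D, hD, rfl⟩, _, hx, by field_simp⟩)
  -- As `0⁻¹ = 0`, the covering condition says nothing at `x = 0`; adding `D₀` secures `0 ∈ D`.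
  obtain ⟨D₀, hD₀, h₀⟩ := h₀
  have hfin' : (insert D₀ (ℱ ∩ 𝒟)).Finite := (hfin.subset Set.inter_subset_left).insert D₀
  have hsub : insert D₀ (ℱ ∩ 𝒟) ⊆ 𝒟 := Set.insert_subset hD₀ Set.inter_subset_right
  refine ⟨⋃₀ insert D₀ (ℱ ∩ 𝒟), Set.sUnion_subset_sUnion hsub, ?_,
    ⟨D₀, Set.mem_insert _ _, h₀⟩, fun x => ?_⟩
  · have := hfin'.to_subtype
    have h := Set.definable_iUnion_of_finite (L := L) (A := Set.univ)
      (f := fun D : (insert D₀ (ℱ ∩ 𝒟) : Set (Set K)) => {x : Fin 1 → K | x 0 ∈ (D : Set K)})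
      fun D => Set.Definable.mono (h𝒟 D (hsub D.2)) (Set.subset_univ _)
    unfold Set.Definable₁
    convert h using 1
    ext x
    simp
  · obtain ⟨D, hD, hx⟩ := hcov x
    rcases hℱ hD with hD' | ⟨D, hD', rfl⟩
    · exact Or.inl ⟨D, Or.inr ⟨hD, hD'⟩, hx⟩
    · obtain ⟨y, hy, rfl⟩ := hx
      refine Or.inr ⟨D, hD', ?_⟩
      have := left_ne_zero_of_mul ht
      simpa [mul_comm x y, this] using hy

/-- A `∨`-definable valuation ring agrees on every finite set with a multiple of one fixed
definable set. -/
theorem IsVeeDefinable.exists_definable_approx {κ : Cardinal.{w}} (hκ : ℵ₀ ≤ κ)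
    (hsat : IsSaturated L K κ) (hK : ExpandsField L K) (O : ValuationSubring K)
    (hO : IsVeeDefinable L κ (O : Set K)) :
    ∃ D : Set K, (Set.univ : Set K).Definable₁ L D ∧ 0 ∈ D ∧
      ∀ F : Finset K, ∃ c, ∀ x ∈ F, x ∈ O ↔ ∃ y ∈ D, c * y = x := by
  -- Such a `t` has the largest negative value. Then `t * x⁻¹ ∈ O` fails for nonzero `x ∈ O`, which
  -- forces `D = O`.
  by_cases hmax : ∃ t, t ∉ O ∧ ∀ x, x ∉ O → t * x⁻¹ ∈ O
  · obtain ⟨t, htO, ht⟩ := hmax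
    have ht₀ : t ≠ 0 := by rintro rfl; exact htO O.zero_mem
    obtain ⟨D, hDO, hD, h₀, hcov⟩ := hO.exists_definable_subset hκ hsat hK O.zero_mem ht₀ fun x => by
      by_cases hx : x ∈ O
      · exact Or.inl hx
      · exact Or.inr ⟨by rintro rfl; exact hx O.zero_mem, ht x hx⟩
    refine ⟨D, hD, h₀, fun F => ⟨1, fun x _ => ⟨fun hx => ⟨x, ?_, one_mul x⟩, ?_⟩⟩⟩
    · by_cases hx₀ : x = 0
      · exact hx₀ ▸ h₀
      · refine (hcov x).resolve_right fun h => htO ?_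
        simpa [hx₀] using O.mul_mem _ _ h hx
    · rintro ⟨y, hy, rfl⟩
      simpa using hDO hy
  push Not at hmax
  by_cases htop : ∀ x, x ∈ O
  · exact ⟨Set.univ, Set.definable_univ, trivial,
      fun F => ⟨1, fun x _ => ⟨fun _ => ⟨x, trivial, one_mul x⟩, fun _ => htop x⟩⟩⟩
  push Not at htop
  obtain ⟨D, hDO, hD, h₀, hcov⟩ := hO.exists_definable_subset hκ hsat hK O.zero_mem
    one_ne_zero fun x => by
      by_cases hx : x ∈ O
      · exact Or.inl hx
      · refine Or.inr ⟨by rintro rfl; exact hx O.zero_mem, ?_⟩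
        simpa using (O.mem_or_inv_mem x).resolve_left hx
  refine ⟨D, hD, h₀, fun F => ?_⟩
  -- That is, `v c` is negative but exceeds the value of every element of `F` outside `O`.
  suffices h : ∃ c, c ∉ O ∧ ∀ x ∈ F, x ∉ O → c⁻¹ * x ∉ O by
    obtain ⟨c, hc, hF⟩ := h
    have hc₀ : c ≠ 0 := by rintro rfl; exact hc O.zero_mem
    refine ⟨c, fun x hx => ⟨fun hxO => ⟨c⁻¹ * x, ?_, by field_simp⟩, ?_⟩⟩
    · by_cases hx₀ : x = 0
      · simpa [hx₀] using h₀
      refine (hcov _).resolve_right fun h => hc ?_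
      convert O.mul_mem _ _ h hxO using 1
      field_simp
    · rintro ⟨y, hy, rfl⟩
      by_contra hxO
      exact hF _ hx hxO (by simpa [hc₀] using hDO hy)
  classical
  induction F using Finset.induction_on with
  | empty => exact htop.imp fun c hc => ⟨hc, by simp⟩
  | insert a F _ ih =>
    obtain ⟨c, hc, hF⟩ := ih
    have hc₀ : c ≠ 0 := by rintro rfl; exact hc O.zero_mem
    by_cases haO : a ∈ O
    · refine ⟨c, hc, fun x hx hxO => ?_⟩
      rcases Finset.mem_insert.1 hx with rfl | hx
      · exact absurd haO hxO
      · exact hF x hx hxO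
    by_cases hca : c⁻¹ * a ∈ O
    · obtain ⟨d, hd, had⟩ := hmax a haO
      have hd₀ : d ≠ 0 := by rintro rfl; exact hd O.zero_mem
      refine ⟨d, hd, fun x hx hxO hdx => ?_⟩
      rcases Finset.mem_insert.1 hx with rfl | hx
      · exact had (by rwa [mul_comm])
      · refine hF x hx hxO ?_
        have hda : a⁻¹ * d ∈ O := by
          simpa [mul_comm] using (O.mem_or_inv_mem (a * d⁻¹)).resolve_left had
        have ha₀ : a ≠ 0 := by rintro rfl; exact haO O.zero_mem
        convert O.mul_mem _ _ (O.mul_mem _ _ hca hda) hdx using 1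
        field_simp
    · refine ⟨c, hc, fun x hx hxO => ?_⟩
      rcases Finset.mem_insert.1 hx with rfl | hx
      · exact hca
      · exact hF x hx hxO

/-- On a finite set, an ideal of a valuation ring agrees with a principal one. -/
theorem exists_mem_ideal_iff_dvd (O : ValuationSubring K) (I : Ideal O) (F : Finset K) :
    ∃ s : O, ∀ x ∈ F, x ∈ (fun x : O => (x : K)) '' (I : Set O) ↔ ∃ y : O, (s : K) * y = x := by
  suffices h : ∃ s ∈ I, ∀ x : O, (x : K) ∈ F → x ∈ I → s ∣ x by
    obtain ⟨s, hs, h⟩ := h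
    refine ⟨s, fun x hx => ⟨?_, ?_⟩⟩
    · rintro ⟨x, hxI, rfl⟩
      obtain ⟨y, rfl⟩ := h x hx hxI
      exact ⟨y, rfl⟩
    · rintro ⟨y, rfl⟩
      exact ⟨s * y, I.mul_mem_right y hs, rfl⟩
  classical
  induction F using Finset.induction_on with
  | empty => exact ⟨0, I.zero_mem, by simp⟩
  | insert a F _ ih =>
    obtain ⟨s, hs, h⟩ := ih
    by_cases ha : ∃ b : O, (b : K) = a ∧ b ∈ I
    · obtain ⟨b, rfl, hb⟩ := ha
      rcases ValuationRing.dvd_total s b with hsb | hbs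
      · refine ⟨s, hs, fun x hx hxI => ?_⟩
        rcases Finset.mem_insert.1 hx with hx | hx
        · exact Subtype.ext hx ▸ hsb
        · exact h x hx hxI
      · refine ⟨b, hb, fun x hx hxI => ?_⟩
        rcases Finset.mem_insert.1 hx with hx | hx
        · rw [Subtype.ext hx]
        · exact hbs.trans (h x hx hxI)
    · refine ⟨s, hs, fun x hx hxI => ?_⟩
      rcases Finset.mem_insert.1 hx with hx | hx
      · exact absurd ⟨x, hx, hxI⟩ ha
      · exact h x hx hxI

/-- Every ideal of a `∨`-definable valuation ring of a saturated field is externally definable. -/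
theorem IsVeeDefinable.isExternallyDefinable_ideal {κ : Cardinal.{w}} (hκ : ℵ₀ ≤ κ)
    (hsat : IsSaturated L K κ) (hK : ExpandsField L K) (O : ValuationSubring K)
    (hO : IsVeeDefinable L κ (O : Set K)) (I : Ideal O) :
    IsExternallyDefinable L ((fun x : O => (x : K)) '' (I : Set O)) := by
  classical
  obtain ⟨D, hD, h₀, hDO⟩ := hO.exists_definable_approx hκ hsat hK O
  refine isExternallyDefinable_of_finite_approx (hK.definable_exists_mul_eq hD) fun F => ?_
  obtain ⟨s, hs⟩ := exists_mem_ideal_iff_dvd O I F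
  -- For `s ≠ 0`, `x ∈ s • O` means `s⁻¹ * x ∈ O`. For `s = 0`, both multiples are `{0}`, because `0
  -- ∈ D`.
  obtain ⟨c, hc⟩ := hDO (F.image fun x => (s : K)⁻¹ * x)
  refine ⟨s * c, fun x hx => (hs x hx).trans ?_⟩
  have hcx := hc _ (Finset.mem_image_of_mem _ hx)
  by_cases hs₀ : (s : K) = 0
  · constructor
    · rintro ⟨y, h⟩
      exact ⟨0, h₀, by simpa [hs₀] using h⟩
    · rintro ⟨y, -, h⟩
      exact ⟨0, by simpa [hs₀] using h⟩
  · constructor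
    · rintro ⟨y, rfl⟩
      obtain ⟨z, hz, h⟩ := hcx.1 (by simp [hs₀])
      refine ⟨z, hz, ?_⟩
      simp only [Matrix.cons_val_zero, Matrix.cons_val_one]
      rw [mul_assoc, h]
      field_simp
    · rintro ⟨z, hz, h⟩
      simp only [Matrix.cons_val_zero, Matrix.cons_val_one] at h
      refine ⟨⟨_, hcx.2 ⟨z, hz, ?_⟩⟩, mul_inv_cancel_left₀ hs₀ x⟩
      rw [← h]
      field_simp

end FieldModelTheory

theorem propositionP (L : FirstOrder.Language.{u, v}) (K : Type w) [Field K] [L.Structure K]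
    (hK : FieldModelTheory.ExpandsField L K)
    (κ : Cardinal.{w}) (hκ : ℵ₀ ≤ κ) (hsat : FieldModelTheory.IsSaturated L K κ)
    (O : ValuationSubring K) (hO : FieldModelTheory.IsVeeDefinable L κ (O : Set K)) :
    FieldModelTheory.IsExternallyDefinable L (O : Set K) ∧
      (FieldModelTheory.IsNIP L K →
        ∀ I : Ideal O,
          FieldModelTheory.IsExternallyDefinable L ((fun x : O => (x : K)) '' (I : Set O))) := by
  have h := hO.isExternallyDefinable_ideal hκ hsat hK O
  refine ⟨?_, fun _ => h⟩
  convert h ⊤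
  ext x
  simp
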